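/- Let $k$ be a field, let $q\in k$ with $q\neq 0$ and $q^2\neq 1$, let $n\ge 2$, and let $(a_{ij})_{1\le i,j\le n-1}$ be the Cartan matrix of $\mathfrak{sl}(n)$: $a_{ii}=2$, $a_{i,i\pm1}=-1$, and $a_{ij}=0$ otherwise. A type assignment gives each of the $2(n-1)$ symbols $E_1,\dots,E_{n-1},F_1,\dots,F_{n-1}$ a type, $1$ or $2$. Reading the $2(n-1)$ binary digits of an integer $0\le d<2^{2(n-1)}$, most significant first, as the types of $E_1,\dots,E_{n-1},F_1,\dots,F_{n-1}$ in this order (digit $1$ for type 1, digit $0$ for type 2) is a bijection between these integers and the type assignments, so there are $2^{2(n-1)}$ of them. For each such $d$ let $w\mathfrak{sl}^d_q(n)$ be the unital associative $k$-algebra with generators $E_i,F_i,K_i,\overline K_i$ ($1\le i\le n-1$) and the relations, for all $i,j$ unless restricted, $$K_iK_j=K_jK_i,\quad \overline K_i\overline K_j=\overline K_j\overline K_i,\quad K_i\overline K_j=\overline K_jK_i,\quad K_i\overline K_i=K_j\overline K_j=:J,$$ $$JK_j=K_jJ=K_j,\qquad J\overline K_j=\overline K_jJ=\overline K_j,\qquad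 E_iF_j-F_jE_i=\delta_{ij}\frac{K_i-\overline K_i}{q-q^{-1}},$$ $$X_i^2X_j-(q+q^{-1})X_iX_jX_i+X_jX_i^2=0\ \ (|i-j|=1),\qquad X_iX_j=X_jX_i\ \ (|i-j|\ge2),\qquad X\in\{E,F\},$$ together with, for each $i$, $$K_jE_i=q^{a_{ij}}E_iK_j,\quad E_i\overline K_j=q^{a_{ij}}\overline K_jE_i\quad\text{for all } j\qquad\text{if } E_i \text{ is of type 1},$$ $$K_jE_i\overline K_j=q^{a_{ij}}E_i\quad\text{for all } j\qquad\text{if } E_i \text{ is of type 2},$$ and the same relations with $F_i$ in place of $E_i$ and $-a_{ij}$ in place of $a_{ij}$, according to the type of $F_i$. Then, for every $d$, there are algebra homomorphisms $\Delta:w\mathfrak{sl}^d_q(n)\to w\mathfrak{sl}^d_q(n)\otimes w\mathfrak{sl}^d_q(n)$ and $\varepsilon:w\mathfrak{sl}^d_q(n)\to k$ with $$\Delta(K_i)=K_i\otimes K_i,\qquad \Delta(\overline K_i)=\overline K_i\otimes\overline K_i,$$ $$\Delta(E_i)=\begin{cases}1\otimes E_i+E_i\otimes K_i,& E_i\text{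 of type 1},\\ J\otimes E_i+E_i\otimes K_i,& E_i\text{ of type 2},\end{cases}\qquad \Delta(F_i)=\begin{cases}F_i\otimes 1+\overline K_i\otimes F_i,& F_i\text{ of type 1},\\ F_i\otimes J+\overline K_i\otimes F_i,& F_i\text{ of type 2},\end{cases}$$ $$\varepsilon(K_i)=\varepsilon(\overline K_i)=1,\qquad \varepsilon(E_i)=\varepsilon(F_i)=0,$$ and they make $w\mathfrak{sl}^d_q(n)$ a bialgebra. Moreover, whatever the types are, there is a $k$-linear unital algebra anti-homomorphism $T:w\mathfrak{sl}^d_q(n)\to w\mathfrak{sl}^d_q(n)$ with $$T(K_i)=\overline K_i,\qquad T(\overline K_i)=K_i,\qquad T(E_i)=-E_i\overline K_i,\qquad T(F_i)=-K_iF_i,$$ and $T$ is a weak antipode: $T*\mathrm{id}*T=T$ and $\mathrm{id}*T*\mathrm{id}=\mathrm{id}$, where $a*b=m\circ(a\otimes b)\circ\Delta$ and $m$ is the multiplication. -/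

import Mathlib

open scoped TensorProduct

/-! ### Bialgebras and weak antipodes -/

section WeakHopf

variable {k H : Type*} [Field k] [Ring H] [Algebra k H]

/-- `(H, Δ, ε)` is a bialgebra: `Δ` and `ε` are algebra homomorphisms, `Δ` is coassociative and
`ε` is a two-sided counit for `Δ`. -/
structure IsBialgebra (Δ : H →ₐ[k] H ⊗[k] H) (ε : H →ₐ[k] k) : Prop where
  coassoc : (Algebra.TensorProduct.assoc k k k H H H).toAlgHom.comp
      ((Algebra.TensorProduct.map Δ (.id k H)).comp Δ)
      = (Algebra.TensorProduct.map (.id k H) Δ).comp Δ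
  counit_left : (Algebra.TensorProduct.map ε (.id k H)).comp Δ
      = (Algebra.TensorProduct.lid k H).symm
  counit_right : (Algebra.TensorProduct.map (.id k H) ε).comp Δ
      = (Algebra.TensorProduct.rid k k H).symm

/-- The data of `IsBialgebra` give a `Bialgebra` in the sense of Mathlib. -/
abbrev IsBialgebra.toBialgebra {Δ : H →ₐ[k] H ⊗[k] H} {ε : H →ₐ[k] k} (h : IsBialgebra Δ ε) :
    Bialgebra k H :=
  Bialgebra.ofAlgHom Δ ε h.coassoc h.counit_left h.counit_right

/-- The convolution product `a * b = m ∘ (a ⊗ b) ∘ Δ` of linear endomaps of `H`. -/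
noncomputable def convolution (Δ : H →ₐ[k] H ⊗[k] H) (a b : H →ₗ[k] H) : H →ₗ[k] H :=
  LinearMap.mul' k H ∘ₗ TensorProduct.map a b ∘ₗ Δ.toLinearMap

/-- `T` is a weak antipode: a unital algebra anti-homomorphism with `T * id * T = T` and
`id * T * id = id` for the convolution product. -/
structure IsWeakAntipode (Δ : H →ₐ[k] H ⊗[k] H) (T : H →ₗ[k] H) : Prop where
  map_one : T 1 = 1
  map_mul : ∀ x y : H, T (x * y) = T y * T x
  conv_T_id_T : convolution Δ (convolution Δ T LinearMap.id) T = T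
  conv_id_T_id : convolution Δ (convolution Δ LinearMap.id T) LinearMap.id = LinearMap.id

end WeakHopf

/-! ### The algebras `wsl_q^d(n)` -/

namespace WSl

/-- The generators; the index `i : Fin (n - 1)` stands for the simple root number `i + 1`. -/
inductive Gen (n : ℕ) : Type
  | E (i : Fin (n - 1))
  | F (i : Fin (n - 1))
  | K (i : Fin (n - 1))
  | Kbar (i : Fin (n - 1))

/-- The Cartan matrix of `sl(n)`. -/
abbrev cartan {n : ℕ} (i j : Fin (n - 1)) : ℤ := CartanMatrix.A (n - 1) i j

/-- A choice of type for each of the `2(n-1)` generators `E_i` (left summand) and `F_i` (right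
summand): `true` is type 1 and `false` is type 2. -/
abbrev TypeAssignment (n : ℕ) : Type := Fin (n - 1) ⊕ Fin (n - 1) → Bool

/-- The type assignment coded by an integer `0 ≤ d < 2^(2(n-1))`: its `2(n-1)` binary digits,
the most significant one first, are the types of `E_1, …, E_{n-1}, F_1, …, F_{n-1}` in this order,
the digit `1` meaning type 1 and the digit `0` meaning type 2. -/
def typesOf (n : ℕ) (d : Fin (2 ^ (2 * (n - 1)))) : TypeAssignment n
  | .inl i => (d : ℕ).testBit (2 * (n - 1) - 1 - i)
  | .inr i => (d : ℕ).testBit (n - 1 - 1 - i)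

section Relations

variable (k : Type*) [Field k] (n : ℕ)

/-- The generator `E_i` in the free algebra. -/
abbrev fE (i : Fin (n - 1)) : FreeAlgebra k (Gen n) := FreeAlgebra.ι k (Gen.E i)
/-- The generator `F_i` in the free algebra. -/
abbrev fF (i : Fin (n - 1)) : FreeAlgebra k (Gen n) := FreeAlgebra.ι k (Gen.F i)
/-- The generator `K_i` in the free algebra. -/
abbrev fK (i : Fin (n - 1)) : FreeAlgebra k (Gen n) := FreeAlgebra.ι k (Gen.K i)
/-- The generator `K̄_i` in the free algebra. -/
abbrev fKbar (i : Fin (n - 1)) : FreeAlgebra k (Gen n) := FreeAlgebra.ι k (Gen.Kbar i)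
/-- The product `K_i K̄_i` in the free algebra; the relation `J_eq` below makes it independent
of `i`, and its common value in the quotient is `J`. -/
abbrev fJ (i : Fin (n - 1)) : FreeAlgebra k (Gen n) := fK k n i * fKbar k n i

/-- The defining relations of `wsl_q^d(n)`. -/
inductive Rel (q : k) (d : TypeAssignment n) :
    FreeAlgebra k (Gen n) → FreeAlgebra k (Gen n) → Prop
  | K_comm (i j) : Rel q d (fK k n i * fK k n j) (fK k n j * fK k n i)
  | Kbar_comm (i j) : Rel q d (fKbar k n i * fKbar k n j) (fKbar k n j * fKbar k n i)
  | K_Kbar_comm (i j) : Rel q d (fK k n i * fKbar k n j) (fKbar k n j * fK k n i)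
  | J_eq (i j) : Rel q d (fJ k n i) (fJ k n j)
  | J_K (i j) : Rel q d (fJ k n i * fK k n j) (fK k n j)
  | K_J (i j) : Rel q d (fK k n j * fJ k n i) (fK k n j)
  | J_Kbar (i j) : Rel q d (fJ k n i * fKbar k n j) (fKbar k n j)
  | Kbar_J (i j) : Rel q d (fKbar k n j * fJ k n i) (fKbar k n j)
  | EF_same (i) : Rel q d (fE k n i * fF k n i - fF k n i * fE k n i)
      ((q - q⁻¹)⁻¹ • (fK k n i - fKbar k n i))
  | EF_diff (i j) (h : i ≠ j) : Rel q d (fE k n i * fF k n j - fF k n j * fE k n i) 0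
  | serreE (i j : Fin (n - 1)) (h : (i : ℕ) + 1 = j ∨ (j : ℕ) + 1 = i) :
      Rel q d (fE k n i ^ 2 * fE k n j - (q + q⁻¹) • (fE k n i * fE k n j * fE k n i)
        + fE k n j * fE k n i ^ 2) 0
  | serreF (i j : Fin (n - 1)) (h : (i : ℕ) + 1 = j ∨ (j : ℕ) + 1 = i) :
      Rel q d (fF k n i ^ 2 * fF k n j - (q + q⁻¹) • (fF k n i * fF k n j * fF k n i)
        + fF k n j * fF k n i ^ 2) 0
  | E_comm (i j : Fin (n - 1)) (h : (i : ℕ) + 2 ≤ j ∨ (j : ℕ) + 2 ≤ i) :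
      Rel q d (fE k n i * fE k n j) (fE k n j * fE k n i)
  | F_comm (i j : Fin (n - 1)) (h : (i : ℕ) + 2 ≤ j ∨ (j : ℕ) + 2 ≤ i) :
      Rel q d (fF k n i * fF k n j) (fF k n j * fF k n i)
  | E_type1_K (i j) (h : d (.inl i) = true) :
      Rel q d (fK k n j * fE k n i) (q ^ cartan i j • (fE k n i * fK k n j))
  | E_type1_Kbar (i j) (h : d (.inl i) = true) :
      Rel q d (fE k n i * fKbar k n j) (q ^ cartan i j • (fKbar k n j * fE k n i))
  | E_type2 (i j) (h : d (.inl i) = false) :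
      Rel q d (fK k n j * fE k n i * fKbar k n j) (q ^ cartan i j • fE k n i)
  | F_type1_K (i j) (h : d (.inr i) = true) :
      Rel q d (fK k n j * fF k n i) (q ^ (-cartan i j) • (fF k n i * fK k n j))
  | F_type1_Kbar (i j) (h : d (.inr i) = true) :
      Rel q d (fF k n i * fKbar k n j) (q ^ (-cartan i j) • (fKbar k n j * fF k n i))
  | F_type2 (i j) (h : d (.inr i) = false) :
      Rel q d (fK k n j * fF k n i * fKbar k n j) (q ^ (-cartan i j) • fF k n i)

end Relations

/-- The unital associative `k`-algebra `wsl_q^d(n)` presented by the generators `Gen n` and the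
relations `Rel k n q d`. -/
abbrev Alg (k : Type*) [Field k] (q : k) (n : ℕ) (d : TypeAssignment n) : Type _ :=
  RingQuot (Rel k n q d)

section Generators

variable {k : Type*} [Field k] {q : k} {n : ℕ} {d : TypeAssignment n}

/-- The image of a generator in `wsl_q^d(n)`. -/
noncomputable def gen (x : Gen n) : Alg k q n d :=
  RingQuot.mkAlgHom k (Rel k n q d) (FreeAlgebra.ι k x)

/-- `E_i`. -/
noncomputable abbrev E (i : Fin (n - 1)) : Alg k q n d := gen (.E i)
/-- `F_i`. -/
noncomputable abbrev F (i : Fin (n - 1)) : Alg k q n d := gen (.F i)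
/-- `K_i`. -/
noncomputable abbrev K (i : Fin (n - 1)) : Alg k q n d := gen (.K i)
/-- `K̄_i`. -/
noncomputable abbrev Kbar (i : Fin (n - 1)) : Alg k q n d := gen (.Kbar i)
/-- `J = K_i K̄_i`, which does not depend on `i`. -/
noncomputable abbrev J (i : Fin (n - 1)) : Alg k q n d := K i * Kbar i

/-- The prescribed values of the coproduct on the generators. -/
structure IsCoproduct (Δ : Alg k q n d →ₐ[k] Alg k q n d ⊗[k] Alg k q n d) : Prop where
  comul_K : ∀ i, Δ (K i) = K i ⊗ₜ[k] K i
  comul_Kbar : ∀ i, Δ (Kbar i) = Kbar i ⊗ₜ[k] Kbar i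
  comul_E_type1 : ∀ i, d (.inl i) = true → Δ (E i) = 1 ⊗ₜ[k] E i + E i ⊗ₜ[k] K i
  comul_E_type2 : ∀ i, d (.inl i) = false → Δ (E i) = J i ⊗ₜ[k] E i + E i ⊗ₜ[k] K i
  comul_F_type1 : ∀ i, d (.inr i) = true → Δ (F i) = F i ⊗ₜ[k] 1 + Kbar i ⊗ₜ[k] F i
  comul_F_type2 : ∀ i, d (.inr i) = false → Δ (F i) = F i ⊗ₜ[k] J i + Kbar i ⊗ₜ[k] F i

/-- The prescribed values of the counit on the generators. -/
structure IsCounit (ε : Alg k q n d →ₐ[k] k) : Prop where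
  counit_K : ∀ i, ε (K i) = 1
  counit_Kbar : ∀ i, ε (Kbar i) = 1
  counit_E : ∀ i, ε (E i) = 0
  counit_F : ∀ i, ε (F i) = 0

/-- The prescribed values of the weak antipode on the generators. -/
structure IsAntipodeOnGenerators (T : Alg k q n d →ₗ[k] Alg k q n d) : Prop where
  apply_K : ∀ i, T (K i) = Kbar i
  apply_Kbar : ∀ i, T (Kbar i) = K i
  apply_E : ∀ i, T (E i) = -(E i * Kbar i)
  apply_F : ∀ i, T (F i) = -(K i * F i)

end Generators

end WSl

/-! ### Binary digits as type assignments. -/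

namespace WSl

/-! The element `J` is a central idempotent, and a type 2 relation for a generator `X` amounts to
the type 1 relations together with `J X = X`. `IsRep` records the relations in this uniform shape,
and a family satisfying it in any algebra defines a homomorphism (`lift`). The structure maps come
from such families in the tensor square, in `k` and in the opposite algebra (`IsRep.comul`,
`isRep_counit`, `IsRep.antipode`). The bialgebra axioms are equalities of homomorphisms, so they are
checked on generators.

The weak antipode identities are not of that kind, since `id * T * id` is not visibly
multiplicative. They are proved after multiplication by `J` and by `1 - J`, whose sum is `1`.

On the `J` part the `K i` are invertible and `T` is an honest antipode: `id * T` and `T * id` reduce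
to the counit.

On the `1 - J` part all `K i`, `Kbar i` and type 2 generators vanish, every `E i` commutes with
every `F j`, and `T` becomes the character `χ` killing all generators (`one_sub_J_mul_antipode`).
Hence `id * T` and `T * id` become the homomorphisms `projF = (id ⊗ χ)Δ` and `projE = (χ ⊗ id)Δ`,
which keep only the type 1 `F i`, respectively `E i`. So `T * id * T` becomes `(projE ⊗ χ)Δ = χ`,
while `id * T * id` becomes `m(projF ⊗ projE)Δ`. The latter is multiplicative there because the `E
i` and `F j` commute, and it fixes the generators, so it is the identity
(`one_sub_J_mul_mul'_map_comul`). -/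

theorem typesOf_bijective (n : ℕ) : Function.Bijective (typesOf n) := by
  rw [Fintype.bijective_iff_injective_and_card]
  refine ⟨fun a b h => ?_, by simp [two_mul]⟩
  have hE (i : Fin (n - 1)) := congrFun h (.inl i)
  have hF (i : Fin (n - 1)) := congrFun h (.inr i)
  simp only [typesOf] at hE hF
  refine Fin.ext (Nat.eq_of_testBit_eq fun t => ?_)
  -- The low `n - 1` bits are the types of the `F i`, the next `n - 1` those of the `E i`; higher
  -- bits vanish on both sides.
  by_cases h₁ : t < n - 1
  · have := hF ⟨n - 1 - 1 - t, by lia⟩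
    rwa [show n - 1 - 1 - (n - 1 - 1 - t) = t by lia] at this
  · by_cases h₂ : t < 2 * (n - 1)
    · have := hE ⟨2 * (n - 1) - 1 - t, by lia⟩
      rwa [show 2 * (n - 1) - 1 - (2 * (n - 1) - 1 - t) = t by lia] at this
    · have hle : 2 ^ (2 * (n - 1)) ≤ 2 ^ t := Nat.pow_le_pow_right two_pos (not_lt.mp h₂)
      rw [Nat.testBit_eq_false_of_lt (a.2.trans_le hle),
        Nat.testBit_eq_false_of_lt (b.2.trans_le hle)]

/-! ### Entries of the Cartan matrix. -/

section Cartan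

variable {n : ℕ}

theorem cartan_self (i : Fin (n - 1)) : cartan i i = 2 := by
  simp [cartan, CartanMatrix.A]

theorem cartan_of_adj {i j : Fin (n - 1)} (h : (i : ℕ) + 1 = j ∨ (j : ℕ) + 1 = i) :
    cartan i j = -1 := by
  have : i ≠ j := fun e => by subst e; lia
  simp [cartan, CartanMatrix.A, this, h]

theorem cartan_of_far {i j : Fin (n - 1)} (h : (i : ℕ) + 2 ≤ j ∨ (j : ℕ) + 2 ≤ i) :
    cartan i j = 0 := by
  have h₁ : i ≠ j := fun e => by subst e; lia
  have h₂ : ¬((i : ℕ) + 1 = j ∨ (j : ℕ) + 1 = i) := by lia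
  simp [cartan, CartanMatrix.A, h₁, h₂]

theorem cartan_comm (i j : Fin (n - 1)) : cartan i j = cartan j i := by
  simp only [cartan, CartanMatrix.A, Matrix.of_apply, eq_comm (a := i), or_comm]

end Cartan

/-! ### Serre, weight and torus relations in arbitrary algebras. -/

variable {k B C : Type*} [Field k] [Ring B] [Algebra k B] [Ring C] [Algebra k C] {n : ℕ}

/-- The quantum Serre relations of type `A_{n-1}` with parameter `p`. -/
structure SerreRel (p : k) (X : Fin (n - 1) → B) : Prop where
  serre : ∀ i j : Fin (n - 1), ((i : ℕ) + 1 = j ∨ (j : ℕ) + 1 = i) →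
    X i ^ 2 * X j - (p + p⁻¹) • (X i * X j * X i) + X j * X i ^ 2 = 0
  comm : ∀ i j : Fin (n - 1), ((i : ℕ) + 2 ≤ j ∨ (j : ℕ) + 2 ≤ i) → X i * X j = X j * X i

/-- `X i` has weight `p ^ cartan i j` with respect to `K j` and `Kb j`. -/
structure WeightRel (p : k) (X K Kb : Fin (n - 1) → B) : Prop where
  K_mul : ∀ i j, K j * X i = p ^ cartan i j • (X i * K j)
  mul_Kb : ∀ i j, X i * Kb j = p ^ cartan i j • (Kb j * X i)

/-- The relations among the `K i` and `Kb i`. -/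
structure TorusRel (K Kb : Fin (n - 1) → B) : Prop where
  K_comm : ∀ i j, Commute (K i) (K j)
  Kb_comm : ∀ i j, Commute (Kb i) (Kb j)
  K_Kb_comm : ∀ i j, Commute (K i) (Kb j)
  J_eq : ∀ i j, K i * Kb i = K j * Kb j
  J_K : ∀ i j, K i * Kb i * K j = K j
  J_Kb : ∀ i j, K i * Kb i * Kb j = Kb j

/-- If `Y` `p`-commutes with `X` according to the Cartan matrix, then `X + Y` inherits the Serre
relations from `X` and `Y`. -/
theorem SerreRel.add {p : k} (hp : p ≠ 0) {X Y : Fin (n - 1) → B} (hX : SerreRel p X)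
    (hY : SerreRel p Y) (h : ∀ i j, Y i * X j = p ^ cartan i j • (X j * Y i)) :
    SerreRel p (fun i => X i + Y i) where
  serre i j hij := by
    have a₁ := h i i
    have a₂ := h i j
    have a₃ := h j i
    rw [cartan_self] at a₁
    rw [cartan_of_adj hij] at a₂
    rw [cartan_of_adj hij.symm] at a₃
    have b₁ (z) : Y i * (X i * z) = p ^ (2 : ℤ) • (X i * (Y i * z)) := by
      rw [← mul_assoc, a₁, smul_mul_assoc, mul_assoc]
    have b₂ (z) : Y i * (X j * z) = p ^ (-1 : ℤ) • (X j * (Y i * z)) := by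
      rw [← mul_assoc, a₂, smul_mul_assoc, mul_assoc]
    have b₃ (z) : Y j * (X i * z) = p ^ (-1 : ℤ) • (X i * (Y j * z)) := by
      rw [← mul_assoc, a₃, smul_mul_assoc, mul_assoc]
    have e₁ := hX.serre i j hij
    have e₂ := hY.serre i j hij
    simp only [sq, mul_assoc, add_mul, mul_add, a₁, a₂, a₃, b₁, b₂, b₃, mul_smul_comm,
      smul_mul_assoc] at e₁ e₂ ⊢
    -- With every `X` moved to the left of every `Y`, the coefficients of the mixed monomials cancel
    -- identically in `p`; what remains is the sum of the two given relations.
    refine Eq.trans ?_ ((congrArg₂ (· + ·) e₁ e₂).trans (add_zero 0))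
    match_scalars <;> field_simp <;> ring
  comm i j hij := by
    have a₁ := h i j
    have a₂ := h j i
    rw [cartan_of_far hij] at a₁
    rw [cartan_of_far hij.symm] at a₂
    simp only [zpow_zero, one_smul] at a₁ a₂
    simp only [mul_add, add_mul, a₁, a₂, hX.comm i j hij, hY.comm i j hij]
    abel

theorem SerreRel.tmul_left {p : k} {X : Fin (n - 1) → B} (hX : SerreRel p X)
    {u : Fin (n - 1) → C} (hu : ∀ i j, Commute (u i) (u j)) :
    SerreRel p (fun i => u i ⊗ₜ[k] X i) where
  serre i j hij := by
    have h₁ : u i * u j * u i = u i ^ 2 * u j := by rw [mul_assoc, (hu j i).eq, sq, mul_assoc]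
    have h₂ : u j * u i ^ 2 = u i ^ 2 * u j := ((hu j i).pow_right 2).eq
    simp only [Algebra.TensorProduct.tmul_pow, Algebra.TensorProduct.tmul_mul_tmul, h₁, h₂,
      ← TensorProduct.tmul_smul, ← TensorProduct.tmul_sub, ← TensorProduct.tmul_add,
      hX.serre i j hij, TensorProduct.tmul_zero]
  comm i j hij := by
    simp only [Algebra.TensorProduct.tmul_mul_tmul, (hu i j).eq, hX.comm i j hij]

theorem SerreRel.map {p : k} {X : Fin (n - 1) → B} (hX : SerreRel p X) (f : B →ₐ[k] C) :
    SerreRel p (fun i => f (X i)) where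
  serre i j hij := by simpa using congrArg f (hX.serre i j hij)
  comm i j hij := by simpa using congrArg f (hX.comm i j hij)

theorem SerreRel.tmul_right {p : k} {X : Fin (n - 1) → B} (hX : SerreRel p X)
    {u : Fin (n - 1) → C} (hu : ∀ i j, Commute (u i) (u j)) :
    SerreRel p (fun i => X i ⊗ₜ[k] u i) := by
  simpa using (hX.tmul_left hu).map (Algebra.TensorProduct.comm k C B).toAlgHom

/-- Only `p + p⁻¹` enters. This lets the `F i`, whose weights are opposite, be treated like the `E
i` with parameter `q⁻¹`. -/
theorem SerreRel.inv {p : k} {X : Fin (n - 1) → B} (hX : SerreRel p X) : SerreRel p⁻¹ X where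
  serre i j hij := by simpa [add_comm] using hX.serre i j hij
  comm := hX.comm

theorem SerreRel.smul {p : k} {X : Fin (n - 1) → B} (hX : SerreRel p X) (c : k) :
    SerreRel p (fun i => c • X i) where
  serre i j hij := by
    have := congrArg (fun z => (c ^ 3) • z) (hX.serre i j hij)
    simp only [smul_zero] at this
    rw [← this]
    simp only [sq, smul_mul_smul_comm]
    module
  comm i j hij := by simp only [smul_mul_smul_comm, hX.comm i j hij]

/-- The Serre expression is invariant under reversing the words. -/
theorem SerreRel.op {p : k} {X : Fin (n - 1) → B} (hX : SerreRel p X) :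
    SerreRel p (fun i => MulOpposite.op (X i)) where
  serre i j hij := by
    rw [← MulOpposite.op_zero, ← hX.serre i j hij]
    simp only [sq, MulOpposite.op_add, MulOpposite.op_sub, MulOpposite.op_mul,
      MulOpposite.op_smul, mul_assoc]
    abel
  comm i j hij := by
    simp only [← MulOpposite.op_mul, hX.comm i j hij]

theorem WeightRel.Kb_mul {p : k} (hp : p ≠ 0) {X K Kb : Fin (n - 1) → B}
    (h : WeightRel p X K Kb) (i j : Fin (n - 1)) :
    Kb j * X i = p⁻¹ ^ cartan i j • (X i * Kb j) := by
  rw [h.mul_Kb, smul_smul, inv_zpow, inv_mul_cancel₀ (zpow_ne_zero _ hp), one_smul]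

theorem WeightRel.mul_K {p : k} (hp : p ≠ 0) {X K Kb : Fin (n - 1) → B}
    (h : WeightRel p X K Kb) (i j : Fin (n - 1)) :
    X i * K j = p⁻¹ ^ cartan i j • (K j * X i) := by
  rw [h.K_mul, smul_smul, inv_zpow, inv_mul_cancel₀ (zpow_ne_zero _ hp), one_smul]

theorem WeightRel.swap {p : k} (hp : p ≠ 0) {X K Kb : Fin (n - 1) → B}
    (h : WeightRel p X K Kb) : WeightRel p⁻¹ X Kb K :=
  ⟨h.Kb_mul hp, h.mul_K hp⟩

/-- `K j * Kb j` commutes with weight vectors. -/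
theorem WeightRel.commute_J {p : k} (hp : p ≠ 0) {X K Kb : Fin (n - 1) → B}
    (h : WeightRel p X K Kb) (i j : Fin (n - 1)) : Commute (K j * Kb j) (X i) := by
  have hp' := zpow_ne_zero (cartan i j) hp
  rw [commute_iff_eq, mul_assoc, h.Kb_mul hp, mul_smul_comm, ← mul_assoc, h.K_mul,
    smul_mul_assoc, smul_smul, inv_zpow, inv_mul_cancel₀ hp', one_smul, mul_assoc]

/-- Each cubic monomial contains two letters of index `i` and one of index `j`. Collecting the torus
factors on the right costs `p⁻¹ ^ (2 - 1 - 1) = 1` in every order, so the whole expression is the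
old one times `Kb i ^ 2 * Kb j`. -/
theorem SerreRel.mul_torus {p : k} (hp : p ≠ 0) {X K Kb : Fin (n - 1) → B} (hX : SerreRel p X)
    (h : WeightRel p X K Kb) (hc : ∀ i j, Commute (Kb i) (Kb j)) :
    SerreRel p (fun i => X i * Kb i) where
  serre i j hij := by
    have a₁ := h.Kb_mul hp i i
    have a₂ := h.Kb_mul hp i j
    have a₃ := h.Kb_mul hp j i
    rw [cartan_self] at a₁
    rw [cartan_of_adj hij] at a₂
    rw [cartan_of_adj hij.symm] at a₃
    have b₁ (z) : Kb i * (X i * z) = p⁻¹ ^ (2 : ℤ) • (X i * (Kb i * z)) := by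
      rw [← mul_assoc, a₁, smul_mul_assoc, mul_assoc]
    have b₂ (z) : Kb j * (X i * z) = p⁻¹ ^ (-1 : ℤ) • (X i * (Kb j * z)) := by
      rw [← mul_assoc, a₂, smul_mul_assoc, mul_assoc]
    have b₃ (z) : Kb i * (X j * z) = p⁻¹ ^ (-1 : ℤ) • (X j * (Kb i * z)) := by
      rw [← mul_assoc, a₃, smul_mul_assoc, mul_assoc]
    have c₁ : Kb j * Kb i = Kb i * Kb j := (hc j i).eq
    have c₂ (z) : Kb j * (Kb i * z) = Kb i * (Kb j * z) := by rw [← mul_assoc, c₁, mul_assoc]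
    have e := congrArg (fun z => z * (Kb i * (Kb i * Kb j))) (hX.serre i j hij)
    simp only [zero_mul] at e
    rw [← e]
    simp only [sq, mul_assoc, add_mul, sub_mul, b₁, b₂, b₃, c₁, c₂, mul_smul_comm,
      smul_mul_assoc]
    match_scalars <;> field_simp
  comm i j hij := by
    have a₁ := h.Kb_mul hp i j
    have a₂ := h.Kb_mul hp j i
    rw [cartan_of_far hij, zpow_zero, one_smul] at a₁
    rw [cartan_of_far hij.symm, zpow_zero, one_smul] at a₂
    rw [mul_assoc, ← mul_assoc (Kb i), a₂, mul_assoc (X j), ← mul_assoc (X i), hX.comm i j hij,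
      mul_assoc (X j) (Kb j), ← mul_assoc (Kb j), a₁, (hc i j).eq]
    simp only [mul_assoc]

end WSl

/-! ### Uniform form of the relations and the universal property. -/

namespace WSl

variable {k B : Type*} [Field k] [Ring B] [Algebra k B] {n : ℕ}

/-- Elements of `B` satisfying the defining relations of `wsl_q^d(n)`. A type 2 relation is
replaced by the corresponding type 1 relations together with `J * X = X`. -/
structure IsRep (q : k) (d : TypeAssignment n) (E F K Kb : Fin (n - 1) → B) : Prop where
  torus : TorusRel K Kb
  weightE : WeightRel q E K Kb
  weightF : WeightRel q⁻¹ F K Kb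
  serreE : SerreRel q E
  serreF : SerreRel q⁻¹ F
  J_E : ∀ i, d (.inl i) = false → ∀ j, K j * Kb j * E i = E i
  J_F : ∀ i, d (.inr i) = false → ∀ j, K j * Kb j * F i = F i
  EF_same : ∀ i, E i * F i - F i * E i = (q - q⁻¹)⁻¹ • (K i - Kb i)
  EF_diff : ∀ i j, i ≠ j → E i * F j - F j * E i = 0

theorem WeightRel.type_two {p : k} (hp : p ≠ 0) {X K Kb : Fin (n - 1) → B}
    (h : WeightRel p X K Kb) {i j : Fin (n - 1)} (hJ : K j * Kb j * X i = X i) :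
    K j * X i * Kb j = p ^ cartan i j • X i := by
  rw [h.K_mul, smul_mul_assoc, mul_assoc, ← (h.commute_J hp i j).eq, hJ]

/-- The product `K j * x * Kb j` is unchanged by `J` on either side, and it is a nonzero multiple of
`x`. -/
theorem TorusRel.J_mul_of_type_two {K Kb : Fin (n - 1) → B} (h : TorusRel K Kb) {c : k}
    (hc : c ≠ 0) {x : B} {j : Fin (n - 1)} (hx : K j * x * Kb j = c • x) :
    K j * Kb j * x = x ∧ x * (K j * Kb j) = x := by
  have hJ : Kb j * (K j * Kb j) = Kb j := by
    rw [((h.K_Kb_comm j j).mul_left (h.Kb_comm j j)).symm.eq, h.J_Kb]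
  constructor <;> refine (IsUnit.mk0 c hc).smul_left_cancel.mp ?_
  · rw [← mul_smul_comm, ← hx, ← mul_assoc, ← mul_assoc, h.J_K]
  · rw [← smul_mul_assoc, ← hx, mul_assoc, hJ]

/-- Multiply the hypothesis by `K j` on the right or by `Kb j` on the left; the resulting `J` is
absorbed by `x`. -/
theorem TorusRel.weight_of_type_two {K Kb : Fin (n - 1) → B} (h : TorusRel K Kb) {c : k}
    (hc : c ≠ 0) {x : B} {j : Fin (n - 1)} (hx : K j * x * Kb j = c • x) :
    K j * x = c • (x * K j) ∧ x * Kb j = c • (Kb j * x) := by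
  obtain ⟨h₁, h₂⟩ := h.J_mul_of_type_two hc hx
  constructor
  · rw [← smul_mul_assoc, ← hx, mul_assoc _ (Kb j), ← (h.K_Kb_comm j j).eq, mul_assoc, h₂]
  · rw [← mul_smul_comm, ← hx, ← mul_assoc, ← mul_assoc, ← (h.K_Kb_comm j j).eq, h₁]

section Universal

variable {q : k} {d : TypeAssignment n} {eB fB kB kbB : Fin (n - 1) → B}

/-- The values of a homomorphism on the generators. -/
def genValue (E F K Kb : Fin (n - 1) → B) : Gen n → B
  | .E i => E i
  | .F i => F i
  | .K i => K i
  | .Kbar i => Kb i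

theorem IsRep.lift_rel (hq0 : q ≠ 0) (h : IsRep q d eB fB kB kbB)
    ⦃x y : FreeAlgebra k (Gen n)⦄ (hxy : Rel k n q d x y) :
    FreeAlgebra.lift k (genValue eB fB kB kbB) x =
      FreeAlgebra.lift k (genValue eB fB kB kbB) y := by
  have hqi := inv_ne_zero hq0
  have t := h.torus
  induction hxy with
  | K_comm i j => simpa [genValue] using (t.K_comm i j).eq
  | Kbar_comm i j => simpa [genValue] using (t.Kb_comm i j).eq
  | K_Kbar_comm i j => simpa [genValue] using (t.K_Kb_comm i j).eq
  | J_eq i j => simpa [genValue] using t.J_eq i j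
  | J_K i j => simpa [genValue] using t.J_K i j
  | K_J i j =>
    have := ((t.K_comm j i).mul_right (t.K_Kb_comm j i)).eq.trans (t.J_K i j)
    simpa [genValue] using this
  | J_Kbar i j => simpa [genValue] using t.J_Kb i j
  | Kbar_J i j =>
    have := ((t.K_Kb_comm i j).symm.mul_right (t.Kb_comm j i)).eq.trans (t.J_Kb i j)
    simpa [genValue] using this
  | EF_same i => simpa [genValue] using h.EF_same i
  | EF_diff i j hij => simpa [genValue] using h.EF_diff i j hij
  | serreE i j hij => simpa [genValue] using h.serreE.serre i j hij
  | serreF i j hij => simpa [genValue] using h.serreF.inv.serre i j hij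
  | E_comm i j hij => simpa [genValue] using h.serreE.comm i j hij
  | F_comm i j hij => simpa [genValue] using h.serreF.comm i j hij
  | E_type1_K i j hi => simpa [genValue] using h.weightE.K_mul i j
  | E_type1_Kbar i j hi => simpa [genValue] using h.weightE.mul_Kb i j
  | E_type2 i j hi => simpa [genValue] using h.weightE.type_two hq0 (h.J_E i hi j)
  | F_type1_K i j hi => simpa [genValue] using h.weightF.K_mul i j
  | F_type1_Kbar i j hi => simpa [genValue] using h.weightF.mul_Kb i j
  | F_type2 i j hi => simpa [genValue] using h.weightF.type_two hqi (h.J_F i hi j)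

/-- The homomorphism from `wsl_q^d(n)` with prescribed values on the generators. -/
noncomputable def lift (hq0 : q ≠ 0) (h : IsRep q d eB fB kB kbB) : Alg k q n d →ₐ[k] B :=
  RingQuot.liftAlgHom k ⟨FreeAlgebra.lift k (genValue eB fB kB kbB), h.lift_rel hq0⟩

theorem lift_gen (hq0 : q ≠ 0) (h : IsRep q d eB fB kB kbB) (x : Gen n) :
    lift hq0 h (gen x) = genValue eB fB kB kbB x := by
  rw [lift, gen, RingQuot.liftAlgHom_mkAlgHom_apply, FreeAlgebra.lift_ι_apply]

theorem algHom_ext {f g : Alg k q n d →ₐ[k] B} (hE : ∀ i, f (E i) = g (E i))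
    (hF : ∀ i, f (F i) = g (F i)) (hK : ∀ i, f (K i) = g (K i))
    (hKb : ∀ i, f (Kbar i) = g (Kbar i)) : f = g := by
  refine RingQuot.ringQuot_ext' _ _ _ (FreeAlgebra.hom_ext (funext fun x => ?_))
  cases x
  exacts [hE _, hF _, hK _, hKb _]

theorem Alg.induction {P : Alg k q n d → Prop} (algebraMap : ∀ r : k, P (algebraMap k _ r))
    (gen : ∀ x, P (gen x)) (mul : ∀ a b, P a → P b → P (a * b))
    (add : ∀ a b, P a → P b → P (a + b)) (x : Alg k q n d) : P x := by
  obtain ⟨x, rfl⟩ := RingQuot.mkAlgHom_surjective k (Rel k n q d) x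
  induction x with
  | grade0 r => simpa using algebraMap r
  | grade1 x => exact gen x
  | mul a b ha hb => simpa using mul _ _ ha hb
  | add a b ha hb => simpa using add _ _ ha hb

theorem isRep_gen (hq0 : q ≠ 0) :
    IsRep q d (E : _ → Alg k q n d) F K Kbar := by
  have r {x y} (h : Rel k n q d x y) := RingQuot.mkAlgHom_rel k h
  have t : TorusRel (K : _ → Alg k q n d) Kbar :=
    { K_comm := fun i j => by simpa [commute_iff_eq, gen] using r (.K_comm i j)
      Kb_comm := fun i j => by simpa [commute_iff_eq, gen] using r (.Kbar_comm i j)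
      K_Kb_comm := fun i j => by simpa [commute_iff_eq, gen] using r (.K_Kbar_comm i j)
      J_eq := fun i j => by simpa [gen] using r (.J_eq i j)
      J_K := fun i j => by simpa [gen] using r (.J_K i j)
      J_Kb := fun i j => by simpa [gen] using r (.J_Kbar i j) }
  have hE {i} (j) (hi : d (.inl i) = false) :
      (K j * E i * Kbar j : Alg k q n d) = q ^ cartan i j • E i := by
    simpa [gen] using r (.E_type2 i j hi)
  have hF {i} (j) (hi : d (.inr i) = false) :
      (K j * F i * Kbar j : Alg k q n d) = q⁻¹ ^ cartan i j • F i := by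
    simpa [gen] using r (.F_type2 i j hi)
  have c₁ (i j : Fin (n - 1)) : q ^ cartan i j ≠ 0 := zpow_ne_zero _ hq0
  have c₂ (i j : Fin (n - 1)) : q⁻¹ ^ cartan i j ≠ 0 := zpow_ne_zero _ (inv_ne_zero hq0)
  refine ⟨t, ⟨fun i j => ?_, fun i j => ?_⟩, ⟨fun i j => ?_, fun i j => ?_⟩,
    ⟨fun i j h => ?_, fun i j h => ?_⟩, SerreRel.inv ⟨fun i j h => ?_, fun i j h => ?_⟩,
    fun i hi j => (t.J_mul_of_type_two (c₁ i j) (hE j hi)).1,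
    fun i hi j => (t.J_mul_of_type_two (c₂ i j) (hF j hi)).1, fun i => ?_, fun i j h => ?_⟩
  · cases hi : d (.inl i)
    · exact (t.weight_of_type_two (c₁ i j) (hE j hi)).1
    · simpa [gen] using r (.E_type1_K i j hi)
  · cases hi : d (.inl i)
    · exact (t.weight_of_type_two (c₁ i j) (hE j hi)).2
    · simpa [gen] using r (.E_type1_Kbar i j hi)
  · cases hi : d (.inr i)
    · exact (t.weight_of_type_two (c₂ i j) (hF j hi)).1
    · simpa [gen] using r (.F_type1_K i j hi)
  · cases hi : d (.inr i)
    · exact (t.weight_of_type_two (c₂ i j) (hF j hi)).2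
    · simpa [gen] using r (.F_type1_Kbar i j hi)
  · simpa [gen] using r (.serreE i j h)
  · simpa [gen] using r (.E_comm i j h)
  · simpa [gen] using r (.serreF i j h)
  · simpa [gen] using r (.F_comm i j h)
  · simpa [gen] using r (.EF_same i)
  · simpa [gen] using r (.EF_diff i j h)

end Universal

end WSl

/-! ### Stability of the relations under tensor squares and opposites. -/

namespace WSl

variable {k B C : Type*} [Field k] [Ring B] [Algebra k B] [Ring C] [Algebra k C] {n : ℕ}

section Weight

variable {p : k} {X Y K Kb : Fin (n - 1) → B}

theorem WeightRel.add (hX : WeightRel p X K Kb) (hY : WeightRel p Y K Kb) :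
    WeightRel p (fun i => X i + Y i) K Kb where
  K_mul i j := by rw [mul_add, add_mul, hX.K_mul, hY.K_mul, smul_add]
  mul_Kb i j := by rw [mul_add, add_mul, hX.mul_Kb, hY.mul_Kb, smul_add]

theorem WeightRel.smul (hX : WeightRel p X K Kb) (c : k) :
    WeightRel p (fun i => c • X i) K Kb where
  K_mul i j := by rw [mul_smul_comm, smul_mul_assoc, hX.K_mul, smul_comm]
  mul_Kb i j := by rw [mul_smul_comm, smul_mul_assoc, hX.mul_Kb, smul_comm]

theorem WeightRel.mul_commuting (hX : WeightRel p X K Kb) {u : Fin (n - 1) → B}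
    (h₁ : ∀ i j, Commute (u i) (K j)) (h₂ : ∀ i j, Commute (u i) (Kb j)) :
    WeightRel p (fun i => X i * u i) K Kb where
  K_mul i j := by
    rw [← mul_assoc, hX.K_mul, smul_mul_assoc, mul_assoc, mul_assoc, (h₁ i j).eq]
  mul_Kb i j := by
    rw [mul_assoc, (h₂ i j).eq, ← mul_assoc, hX.mul_Kb, smul_mul_assoc, mul_assoc]

/-- Reversing products exchanges the two weight relations, so `K` and `Kb` trade places, as the
values of `T` on them require. -/
theorem WeightRel.op (hX : WeightRel p X K Kb) :
    WeightRel p (fun i => MulOpposite.op (X i)) (fun i => MulOpposite.op (Kb i))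
      (fun i => MulOpposite.op (K i)) where
  K_mul i j := by
    simp only [← MulOpposite.op_mul, hX.mul_Kb, MulOpposite.op_smul]
  mul_Kb i j := by
    simp only [← MulOpposite.op_mul, hX.K_mul, MulOpposite.op_smul]

theorem WeightRel.tmul_left (hX : WeightRel p X K Kb) {u L Lb : Fin (n - 1) → C}
    (h₁ : ∀ i j, Commute (u i) (L j)) (h₂ : ∀ i j, Commute (u i) (Lb j)) :
    WeightRel p (fun i => u i ⊗ₜ[k] X i) (fun i => L i ⊗ₜ[k] K i)
      (fun i => Lb i ⊗ₜ[k] Kb i) where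
  K_mul i j := by
    simp only [Algebra.TensorProduct.tmul_mul_tmul, hX.K_mul, (h₁ i j).eq,
      TensorProduct.tmul_smul]
  mul_Kb i j := by
    simp only [Algebra.TensorProduct.tmul_mul_tmul, hX.mul_Kb, (h₂ i j).eq,
      TensorProduct.tmul_smul]

theorem WeightRel.tmul_right (hX : WeightRel p X K Kb) {u L Lb : Fin (n - 1) → C}
    (h₁ : ∀ i j, Commute (u i) (L j)) (h₂ : ∀ i j, Commute (u i) (Lb j)) :
    WeightRel p (fun i => X i ⊗ₜ[k] u i) (fun i => K i ⊗ₜ[k] L i)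
      (fun i => Kb i ⊗ₜ[k] Lb i) where
  K_mul i j := by
    simp only [Algebra.TensorProduct.tmul_mul_tmul, hX.K_mul, (h₁ i j).eq,
      TensorProduct.smul_tmul']
  mul_Kb i j := by
    simp only [Algebra.TensorProduct.tmul_mul_tmul, hX.mul_Kb, (h₂ i j).eq,
      TensorProduct.smul_tmul']

end Weight

theorem TorusRel.op {K Kb : Fin (n - 1) → B} (h : TorusRel K Kb) :
    TorusRel (fun i => MulOpposite.op (Kb i)) (fun i => MulOpposite.op (K i)) where
  K_comm i j := (h.Kb_comm i j).op
  Kb_comm i j := (h.K_comm i j).op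
  K_Kb_comm i j := (h.K_Kb_comm j i).symm.op
  J_eq i j := by simp only [← MulOpposite.op_mul, h.J_eq i j]
  J_K i j := by
    rw [← MulOpposite.op_mul, ← MulOpposite.op_mul,
      ((h.K_Kb_comm i j).symm.mul_right (h.Kb_comm j i)).eq, h.J_Kb]
  J_Kb i j := by
    rw [← MulOpposite.op_mul, ← MulOpposite.op_mul,
      ((h.K_comm j i).mul_right (h.K_Kb_comm j i)).eq, h.J_K]

theorem TorusRel.tmul {K Kb : Fin (n - 1) → B} (h : TorusRel K Kb) :
    TorusRel (fun i => K i ⊗ₜ[k] K i) (fun i => Kb i ⊗ₜ[k] Kb i) where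
  K_comm i j := by
    simp only [commute_iff_eq, Algebra.TensorProduct.tmul_mul_tmul, (h.K_comm i j).eq]
  Kb_comm i j := by
    simp only [commute_iff_eq, Algebra.TensorProduct.tmul_mul_tmul, (h.Kb_comm i j).eq]
  K_Kb_comm i j := by
    simp only [commute_iff_eq, Algebra.TensorProduct.tmul_mul_tmul, (h.K_Kb_comm i j).eq]
  J_eq i j := by simp only [Algebra.TensorProduct.tmul_mul_tmul, h.J_eq i j]
  J_K i j := by simp only [Algebra.TensorProduct.tmul_mul_tmul, h.J_K i j]
  J_Kb i j := by simp only [Algebra.TensorProduct.tmul_mul_tmul, h.J_Kb i j]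

/-- The group-like companion of a generator: `1` for type 1 and `J` for type 2. -/
def unitPart (b : Bool) (J : B) : B := bif b then 1 else J

theorem commute_unitPart {J x : B} (h : Commute J x) (b : Bool) : Commute (unitPart b J) x := by
  cases b
  exacts [h, Commute.one_left x]

theorem TorusRel.commute_J_K {K Kb : Fin (n - 1) → B} (h : TorusRel K Kb) (i j : Fin (n - 1)) :
    Commute (K i * Kb i) (K j) :=
  (h.K_comm i j).mul_left (h.K_Kb_comm j i).symm

theorem TorusRel.commute_J_Kb {K Kb : Fin (n - 1) → B} (h : TorusRel K Kb) (i j : Fin (n - 1)) :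
    Commute (K i * Kb i) (Kb j) :=
  (h.K_Kb_comm i j).mul_left (h.Kb_comm i j)

variable {q : k} {d : TypeAssignment n} {eB fB kB kbB : Fin (n - 1) → B}

theorem IsRep.comul (hq0 : q ≠ 0) (h : IsRep q d eB fB kB kbB) :
    IsRep q d
      (fun i => unitPart (d (.inl i)) (kB i * kbB i) ⊗ₜ[k] eB i + eB i ⊗ₜ[k] kB i)
      (fun i => fB i ⊗ₜ[k] unitPart (d (.inr i)) (kB i * kbB i) + kbB i ⊗ₜ[k] fB i)
      (fun i => kB i ⊗ₜ[k] kB i) (fun i => kbB i ⊗ₜ[k] kbB i) := by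
  have hqi := inv_ne_zero hq0
  have t := h.torus
  have uK (b i j) : Commute (unitPart b (kB i * kbB i)) (kB j) :=
    commute_unitPart (t.commute_J_K i j) b
  have uKb (b i j) : Commute (unitPart b (kB i * kbB i)) (kbB j) :=
    commute_unitPart (t.commute_J_Kb i j) b
  have uE (b i j) : Commute (unitPart b (kB i * kbB i)) (eB j) :=
    commute_unitPart (h.weightE.commute_J hq0 j i) b
  have uF (b i j) : Commute (unitPart b (kB i * kbB i)) (fB j) :=
    commute_unitPart (h.weightF.commute_J hqi j i) b
  have uu (b c i j) : Commute (unitPart b (kB i * kbB i)) (unitPart c (kB j * kbB j)) :=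
    commute_unitPart
      (commute_unitPart ((t.commute_J_K j i).mul_right (t.commute_J_Kb j i)) c).symm b
  have bracket (i j) :
      (unitPart (d (.inl i)) (kB i * kbB i) ⊗ₜ[k] eB i + eB i ⊗ₜ[k] kB i) *
        (fB j ⊗ₜ[k] unitPart (d (.inr j)) (kB j * kbB j) + kbB j ⊗ₜ[k] fB j) -
      (fB j ⊗ₜ[k] unitPart (d (.inr j)) (kB j * kbB j) + kbB j ⊗ₜ[k] fB j) *
        (unitPart (d (.inl i)) (kB i * kbB i) ⊗ₜ[k] eB i + eB i ⊗ₜ[k] kB i) =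
      (unitPart (d (.inl i)) (kB i * kbB i) * kbB j) ⊗ₜ[k] (eB i * fB j - fB j * eB i) +
        (eB i * fB j - fB j * eB i) ⊗ₜ[k] (unitPart (d (.inr j)) (kB j * kbB j) * kB i) := by
    -- The factors `q ^ a` and `q ^ (-a)` from the two tensor legs cancel, by symmetry of the Cartan
    -- matrix.
    have cross : (eB i * kbB j) ⊗ₜ[k] (kB i * fB j) = (kbB j * eB i) ⊗ₜ[k] (fB j * kB i) := by
      rw [h.weightE.mul_Kb, h.weightF.K_mul, TensorProduct.smul_tmul_smul, cartan_comm j i,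
        inv_zpow, mul_inv_cancel₀ (zpow_ne_zero _ hq0), one_smul]
    simp only [mul_add, add_mul, Algebra.TensorProduct.tmul_mul_tmul, cross, (uF _ i j).eq,
      (uE _ j i).eq, ← (uKb _ i j).eq, ← (uK _ j i).eq, TensorProduct.tmul_sub,
      TensorProduct.sub_tmul]
    abel
  have eKb (b i j) : unitPart b (kB i * kbB i) * kbB j = kbB j := by
    cases b
    exacts [t.J_Kb i j, one_mul _]
  have eK (b i j) : unitPart b (kB i * kbB i) * kB j = kB j := by
    cases b
    exacts [t.J_K i j, one_mul _]
  refine ⟨t.tmul, ?_, ?_, ?_, ?_, fun i hi j => ?_, fun i hi j => ?_, fun i => ?_,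
    fun i j hij => ?_⟩
  · exact (h.weightE.tmul_left (fun i => uK _ i) (fun i => uKb _ i)).add
      (h.weightE.tmul_right t.K_comm t.K_Kb_comm)
  · exact (h.weightF.tmul_right (fun i => uK _ i) (fun i => uKb _ i)).add
      (h.weightF.tmul_left (fun i j => (t.K_Kb_comm j i).symm) t.Kb_comm)
  · refine (h.serreE.tmul_left fun i j => uu _ _ i j).add hq0 (h.serreE.tmul_right t.K_comm)
      fun i j => ?_
    simp only [Algebra.TensorProduct.tmul_mul_tmul, h.weightE.K_mul, cartan_comm j i,
      TensorProduct.tmul_smul, (uE _ j i).eq]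
  -- The summands are exchanged so that the commutation factor is a power of `q⁻¹`, the parameter of
  -- `h.serreF`; in the given order it would be a power of `q`.
  · simp only [add_comm (fB _ ⊗ₜ[k] _)]
    refine (h.serreF.tmul_left t.Kb_comm).add hqi (h.serreF.tmul_right fun i j => uu _ _ i j)
      fun i j => ?_
    simp only [Algebra.TensorProduct.tmul_mul_tmul, h.weightF.mul_Kb,
      TensorProduct.smul_tmul', (uF _ i j).eq]
  · have e₁ : kB j * kbB j * (kB i * kbB i) = kB i * kbB i := by rw [← mul_assoc, t.J_K]
    simp only [hi, unitPart, cond_false, mul_add, Algebra.TensorProduct.tmul_mul_tmul, e₁,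
      h.J_E i hi j, t.J_K]
  · have e₁ : kB j * kbB j * (kB i * kbB i) = kB i * kbB i := by rw [← mul_assoc, t.J_K]
    simp only [hi, unitPart, cond_false, mul_add, Algebra.TensorProduct.tmul_mul_tmul, e₁,
      h.J_F i hi j, t.J_Kb]
  -- The unit parts are absorbed, and `Kb ⊗ (K - Kb) + (K - Kb) ⊗ K` telescopes to `K ⊗ K - Kb ⊗
  -- Kb`.
  · rw [bracket, h.EF_same, eK, eKb, TensorProduct.tmul_smul, ← TensorProduct.smul_tmul',
      ← smul_add, TensorProduct.tmul_sub, TensorProduct.sub_tmul]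
    congr 1
    abel
  · rw [bracket, h.EF_diff i j hij, TensorProduct.tmul_zero, TensorProduct.zero_tmul, add_zero]

theorem IsRep.antipode (hq0 : q ≠ 0) (h : IsRep q d eB fB kB kbB) :
    IsRep q d (fun i => MulOpposite.op (-(eB i * kbB i))) (fun i => MulOpposite.op (-(kB i * fB i)))
      (fun i => MulOpposite.op (kbB i)) (fun i => MulOpposite.op (kB i)) := by
  have hqi := inv_ne_zero hq0
  have t := h.torus
  have hE : (fun i => MulOpposite.op (-(eB i * kbB i)))
      = fun i => MulOpposite.op ((-1 : k) • (eB i * kbB i)) := by simp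
  -- Moving `K i` to the right of `F i` brings the family into the form of `SerreRel.mul_torus` and
  -- `WeightRel.mul_commuting`.
  have hF : (fun i => MulOpposite.op (-(kB i * fB i)))
      = fun i => MulOpposite.op ((-q⁻¹ ^ (2 : ℤ)) • (fB i * kB i)) := by
    funext i
    rw [h.weightF.K_mul, cartan_self, neg_smul]
  have bracket (i j) : kB j * fB j * (eB i * kbB i) - eB i * kbB i * (kB j * fB j) =
      (q⁻¹ ^ (2 : ℤ) * q ^ cartan i j) • ((fB j * eB i - eB i * fB j) * (kB j * kbB i)) := by
    have e₁ : kB j * fB j * (eB i * kbB i) =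
        (q⁻¹ ^ (2 : ℤ) * q ^ cartan i j) • (fB j * eB i * (kB j * kbB i)) := by
      rw [h.weightF.K_mul, cartan_self, smul_mul_assoc, mul_assoc, ← mul_assoc (kB j),
        h.weightE.K_mul, smul_mul_assoc, mul_smul_comm, smul_smul]
      simp only [mul_assoc]
    have e₂ : eB i * kbB i * (kB j * fB j) =
        (q⁻¹ ^ (2 : ℤ) * q ^ cartan i j) • (eB i * fB j * (kB j * kbB i)) := by
      rw [h.weightF.K_mul, cartan_self, mul_smul_comm, mul_assoc, ← mul_assoc (kbB i),
        h.weightF.Kb_mul hqi, smul_mul_assoc, mul_smul_comm, smul_smul, inv_inv, cartan_comm j i,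
        mul_assoc, ← (t.K_Kb_comm j i).eq]
      simp only [mul_assoc]
    rw [e₁, e₂, sub_mul, smul_sub]
  refine ⟨t.op, ?_, ?_, ?_, ?_, fun i hi j => ?_, fun i hi j => ?_, fun i => ?_,
    fun i j hij => ?_⟩
  · rw [hE]
    exact ((h.weightE.mul_commuting (fun i j => (t.K_Kb_comm j i).symm) t.Kb_comm).smul _).op
  · rw [hF]
    exact ((h.weightF.mul_commuting t.K_comm t.K_Kb_comm).smul _).op
  · rw [hE]
    exact ((h.serreE.mul_torus hq0 h.weightE t.Kb_comm).smul _).op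
  · rw [hF]
    have := (h.serreF.inv.mul_torus (inv_ne_zero hqi) (h.weightF.swap hqi) t.K_comm).inv
    rw [inv_inv] at this
    exact (this.smul _).op
  · rw [← MulOpposite.op_mul, ← MulOpposite.op_mul, neg_mul, mul_assoc,
      ← ((t.commute_J_Kb j i).eq), ← mul_assoc, ← (h.weightE.commute_J hq0 i j).eq, h.J_E i hi]
  · rw [← MulOpposite.op_mul, ← MulOpposite.op_mul, neg_mul, mul_assoc,
      ← (h.weightF.commute_J hqi i j).eq, h.J_F i hi]
  · simp only [← MulOpposite.op_mul, ← MulOpposite.op_sub, ← MulOpposite.op_smul, neg_mul_neg]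
    rw [bracket, cartan_self, ← neg_sub (eB i * fB i), h.EF_same, inv_zpow,
      inv_mul_cancel₀ (zpow_ne_zero _ hq0), one_smul, neg_mul, smul_mul_assoc, ← smul_neg,
      sub_mul, ← (t.commute_J_K i i).eq, ← (t.commute_J_Kb i i).eq, t.J_K, t.J_Kb, neg_sub]
  · simp only [← MulOpposite.op_mul, ← MulOpposite.op_sub, neg_mul_neg]
    rw [bracket, ← neg_sub (eB i * fB j), h.EF_diff i j hij]
    simp

theorem isRep_counit (q : k) (d : TypeAssignment n) :
    IsRep q d (fun _ => (0 : k)) (fun _ => 0) (fun _ => 1) (fun _ => 1) := by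
  refine ⟨?_, ?_, ?_, ?_, ?_, ?_, ?_, ?_, ?_⟩ <;> (try constructor) <;> simp

/-- Nothing forces `J` to be `1`, so even the `K i` may be sent to `0`. The resulting character
governs the `1 - J` part. -/
theorem isRep_zero (q : k) (d : TypeAssignment n) :
    IsRep q d (fun _ => (0 : k)) (fun _ => 0) (fun _ => 0) (fun _ => 0) := by
  refine ⟨?_, ?_, ?_, ?_, ?_, ?_, ?_, ?_, ?_⟩ <;> (try constructor) <;> simp

end WSl

/-! ### Convolution modulo a central element. -/

section Convolution

variable {k H : Type*} [Field k] [Ring H] [Algebra k H]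

theorem eq_of_mul_eq_of_one_sub_mul_eq {J x y : H} (h₁ : J * x = J * y)
    (h₂ : (1 - J) * x = (1 - J) * y) : x = y := by
  simpa [sub_mul, h₁] using h₂

/-- Modulo a central element `c`, a product `a x * b y` depends on `a` and `b` modulo `c` only. -/
theorem central_mul_mul'_map {c : H} (hc : ∀ x, Commute c x) {a a' b b' : H →ₗ[k] H}
    (ha : ∀ x, c * a x = c * a' x) (hb : ∀ x, c * b x = c * b' x) (t : H ⊗[k] H) :
    c * LinearMap.mul' k H (TensorProduct.map a b t) =
      c * LinearMap.mul' k H (TensorProduct.map a' b' t) := by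
  induction t with
  | zero => simp
  | add s t hs ht => simp only [map_add, mul_add, hs, ht]
  | tmul x y =>
    simp only [TensorProduct.map_tmul, LinearMap.mul'_apply]
    rw [← mul_assoc, ha, (hc _).eq, mul_assoc, hb, ← mul_assoc, ← (hc _).eq, mul_assoc]

theorem mul'_map_scalar_right (f : H →ₐ[k] H) (χ : H →ₐ[k] k) (t : H ⊗[k] H) :
    LinearMap.mul' k H
        (TensorProduct.map f.toLinearMap (Algebra.linearMap k H ∘ₗ χ.toLinearMap) t) =
      Algebra.TensorProduct.rid k k H (Algebra.TensorProduct.map f χ t) := by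
  induction t with
  | zero => simp
  | add s t hs ht => simp only [map_add, hs, ht]
  | tmul x y => simp [Algebra.algebraMap_eq_smul_one]

theorem mul'_map_scalar_left (g : H →ₗ[k] H) (χ : H →ₐ[k] k) (t : H ⊗[k] H) :
    LinearMap.mul' k H (TensorProduct.map (Algebra.linearMap k H ∘ₗ χ.toLinearMap) g t) =
      g (Algebra.TensorProduct.lid k H (Algebra.TensorProduct.map χ (.id k H) t)) := by
  induction t with
  | zero => simp
  | add s t hs ht => simp only [map_add, hs, ht]
  | tmul x y => simp [Algebra.algebraMap_eq_smul_one]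

variable {T : H →ₗ[k] H}

theorem mul'_map_id_anti_tmul_mul (hT : ∀ x y, T (x * y) = T y * T x) (a b : H)
    (s : H ⊗[k] H) :
    LinearMap.mul' k H (TensorProduct.map LinearMap.id T (a ⊗ₜ b * s)) =
      a * LinearMap.mul' k H (TensorProduct.map LinearMap.id T s) * T b := by
  induction s with
  | zero => simp
  | add s t hs ht => simp only [map_add, mul_add, add_mul, hs, ht]
  | tmul x y => simp [hT, mul_assoc]

theorem mul'_map_anti_id_mul_tmul (hT : ∀ x y, T (x * y) = T y * T x) (a b : H)
    (s : H ⊗[k] H) :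
    LinearMap.mul' k H (TensorProduct.map T LinearMap.id (s * a ⊗ₜ b)) =
      T a * LinearMap.mul' k H (TensorProduct.map T LinearMap.id s) * b := by
  induction s with
  | zero => simp
  | add s t hs ht => simp only [map_add, mul_add, add_mul, hs, ht]
  | tmul x y => simp [hT, mul_assoc]

/-- Since `T` reverses products, `s` ends up innermost, between `a` and `T b`. If it contributes a
scalar there, that scalar can be pulled out, which carries the antipode identity from factors to
products. -/
theorem central_mul_mul'_map_id_anti_mul (hT : ∀ x y, T (x * y) = T y * T x) {J : H}
    (hJ : ∀ x, Commute J x) {e : k} {s : H ⊗[k] H}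
    (hs : J * LinearMap.mul' k H (TensorProduct.map LinearMap.id T s) = e • J) (t : H ⊗[k] H) :
    J * LinearMap.mul' k H (TensorProduct.map LinearMap.id T (t * s)) =
      e • (J * LinearMap.mul' k H (TensorProduct.map LinearMap.id T t)) := by
  induction t with
  | zero => simp
  | add t t' h h' => simp only [add_mul, map_add, mul_add, smul_add, h, h']
  | tmul a b =>
    rw [mul'_map_id_anti_tmul_mul hT, ← mul_assoc, ← mul_assoc, (hJ a).eq, mul_assoc a, hs,
      mul_smul_comm, smul_mul_assoc, ← (hJ a).eq, mul_assoc]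
    simp

theorem central_mul_mul'_map_anti_id_mul (hT : ∀ x y, T (x * y) = T y * T x) {J : H}
    (hJ : ∀ x, Commute J x) {e : k} {s : H ⊗[k] H}
    (hs : J * LinearMap.mul' k H (TensorProduct.map T LinearMap.id s) = e • J) (t : H ⊗[k] H) :
    J * LinearMap.mul' k H (TensorProduct.map T LinearMap.id (s * t)) =
      e • (J * LinearMap.mul' k H (TensorProduct.map T LinearMap.id t)) := by
  induction t with
  | zero => simp
  | add t t' h h' => simp only [mul_add, map_add, smul_add, h, h']
  | tmul a b =>
    rw [mul'_map_anti_id_mul_tmul hT, ← mul_assoc, ← mul_assoc, (hJ (T a)).eq, mul_assoc (T a),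
      hs, mul_smul_comm, smul_mul_assoc, ← (hJ (T a)).eq, mul_assoc]
    simp

end Convolution

/-! ### The structure maps and the bialgebra axioms. -/

namespace WSl

variable {k : Type*} [Field k] {q : k} {n : ℕ} {d : TypeAssignment n}

/-- The coproduct. -/
noncomputable def comul (hq0 : q ≠ 0) : Alg k q n d →ₐ[k] Alg k q n d ⊗[k] Alg k q n d :=
  lift hq0 ((isRep_gen hq0).comul hq0)

/-- The counit. -/
noncomputable def counit (hq0 : q ≠ 0) : Alg k q n d →ₐ[k] k :=
  lift hq0 (isRep_counit q d)

/-- The character which vanishes on all generators. -/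
noncomputable def augmentation (hq0 : q ≠ 0) : Alg k q n d →ₐ[k] k :=
  lift hq0 (isRep_zero q d)

/-- The weak antipode. -/
noncomputable def antipode (hq0 : q ≠ 0) : Alg k q n d →ₗ[k] Alg k q n d :=
  (MulOpposite.opLinearEquiv k).symm.toLinearMap ∘ₗ
    (lift hq0 ((isRep_gen hq0).antipode hq0)).toLinearMap

section Values

variable (hq0 : q ≠ 0) (i : Fin (n - 1))

theorem comul_E : comul (d := d) hq0 (E i) =
    unitPart (d (.inl i)) (K i * Kbar i) ⊗ₜ[k] E i + E i ⊗ₜ[k] K i := lift_gen _ _ _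
theorem comul_F : comul (d := d) hq0 (F i) =
    F i ⊗ₜ[k] unitPart (d (.inr i)) (K i * Kbar i) + Kbar i ⊗ₜ[k] F i := lift_gen _ _ _
theorem comul_K : comul (d := d) hq0 (K i) = K i ⊗ₜ[k] K i := lift_gen _ _ _
theorem comul_Kbar : comul (d := d) hq0 (Kbar i) = Kbar i ⊗ₜ[k] Kbar i := lift_gen _ _ _

theorem counit_E : counit (d := d) hq0 (E i) = 0 := lift_gen _ _ _
theorem counit_F : counit (d := d) hq0 (F i) = 0 := lift_gen _ _ _
theorem counit_K : counit (d := d) hq0 (K i) = 1 := lift_gen _ _ _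
theorem counit_Kbar : counit (d := d) hq0 (Kbar i) = 1 := lift_gen _ _ _

theorem augmentation_gen (x : Gen n) : augmentation (d := d) hq0 (gen x) = 0 := by
  rw [augmentation, lift_gen]
  cases x <;> rfl

theorem antipode_gen (x : Gen n) : antipode (d := d) hq0 (gen x) =
    (genValue (fun i => MulOpposite.op (-(E i * Kbar i : Alg k q n d)))
      (fun i => MulOpposite.op (-(K i * F i))) (fun i => MulOpposite.op (Kbar i))
      (fun i => MulOpposite.op (K i)) x).unop := by
  rw [← lift_gen hq0 ((isRep_gen hq0).antipode hq0)]
  rfl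

theorem antipode_E : antipode (d := d) hq0 (E i) = -(E i * Kbar i) := antipode_gen _ _
theorem antipode_F : antipode (d := d) hq0 (F i) = -(K i * F i) := antipode_gen _ _
theorem antipode_K : antipode (d := d) hq0 (K i) = Kbar i := antipode_gen _ _
theorem antipode_Kbar : antipode (d := d) hq0 (Kbar i) = K i := antipode_gen _ _

theorem antipode_E_eq_smul :
    antipode (d := d) hq0 (E i) = (-1 : k) • (E i * Kbar i) :=
  (antipode_E hq0 i).trans (neg_one_smul k _).symm
theorem antipode_F_eq_smul :
    antipode (d := d) hq0 (F i) = (-1 : k) • (K i * F i) :=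
  (antipode_F hq0 i).trans (neg_one_smul k _).symm

theorem antipode_one : antipode (d := d) hq0 1 = 1 := by
  simp [antipode]

theorem antipode_mul (x y : Alg k q n d) :
    antipode hq0 (x * y) = antipode hq0 y * antipode hq0 x := by
  simp [antipode]

theorem antipode_unitPart (b : Bool) :
    antipode (d := d) hq0 (unitPart b (K i * Kbar i)) = unitPart b (K i * Kbar i) := by
  cases b
  · simp only [unitPart, cond_false, antipode_mul, antipode_K, antipode_Kbar]
  · exact antipode_one hq0

theorem counit_unitPart (b : Bool) :
    counit (d := d) hq0 (unitPart b (K i * Kbar i)) = 1 := by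
  cases b
  · simp only [unitPart, cond_false, map_mul, counit_K, counit_Kbar, one_mul]
  · exact map_one _

theorem comul_unitPart (b : Bool) :
    comul (d := d) hq0 (unitPart b (K i * Kbar i)) =
      unitPart b (K i * Kbar i) ⊗ₜ[k] unitPart b (K i * Kbar i) := by
  cases b
  · simp only [unitPart, cond_false, map_mul, comul_K, comul_Kbar,
      Algebra.TensorProduct.tmul_mul_tmul]
  · exact map_one _

end Values

theorem isBialgebra_comul_counit (hq0 : q ≠ 0) :
    IsBialgebra (comul (d := d) hq0) (counit hq0) where
  coassoc := by
    refine algHom_ext (fun i => ?_) (fun i => ?_) (fun i => ?_) (fun i => ?_) <;>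
    simp [comul_E, comul_F, comul_K, comul_Kbar, comul_unitPart, TensorProduct.add_tmul,
      TensorProduct.tmul_add, add_assoc]
  counit_left := by
    refine algHom_ext (fun i => ?_) (fun i => ?_) (fun i => ?_) (fun i => ?_) <;>
    simp [comul_E, comul_F, comul_K, comul_Kbar, counit_unitPart, counit_E, counit_F, counit_K,
      counit_Kbar]
  counit_right := by
    refine algHom_ext (fun i => ?_) (fun i => ?_) (fun i => ?_) (fun i => ?_) <;>
    simp [comul_E, comul_F, comul_K, comul_Kbar, counit_unitPart, counit_E, counit_F, counit_K,
      counit_Kbar]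

end WSl

/-! ### The parts cut out by `J` and `1 - J`. -/

namespace WSl

variable {k : Type*} [Field k] {q : k} {n : ℕ} {d : TypeAssignment n}

theorem commute_J (hq0 : q ≠ 0) (i : Fin (n - 1)) (x : Alg k q n d) : Commute (J i) x := by
  have h := isRep_gen (d := d) hq0
  induction x using Alg.induction with
  | algebraMap r => exact (Algebra.commutes r _).symm
  | gen x =>
    cases x with
    | E j => exact h.weightE.commute_J hq0 j i
    | F j => exact h.weightF.commute_J (inv_ne_zero hq0) j i
    | K j => exact h.torus.commute_J_K i j
    | Kbar j => exact h.torus.commute_J_Kb i j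
  | mul a b ha hb => exact ha.mul_right hb
  | add a b ha hb => exact ha.add_right hb

theorem commute_one_sub_J (hq0 : q ≠ 0) (i : Fin (n - 1)) (x : Alg k q n d) :
    Commute (1 - J i) x :=
  (Commute.one_left x).sub_left (commute_J hq0 i x)

theorem J_mul_J (hq0 : q ≠ 0) (i j : Fin (n - 1)) : (J i * J j : Alg k q n d) = J j := by
  rw [← mul_assoc, (isRep_gen hq0).torus.J_K]

theorem J_eq (hq0 : q ≠ 0) (i j : Fin (n - 1)) : (J i : Alg k q n d) = J j :=
  (isRep_gen hq0).torus.J_eq i j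

theorem J_mul_unitPart (hq0 : q ≠ 0) (i j : Fin (n - 1)) (b : Bool) :
    (J i * unitPart b (J j) : Alg k q n d) = J i := by
  cases b
  · exact (J_mul_J hq0 i j).trans (J_eq hq0 j i)
  · exact mul_one _

theorem one_sub_J_mul_K (hq0 : q ≠ 0) (i j : Fin (n - 1)) :
    ((1 - J i) * K j : Alg k q n d) = 0 := by
  rw [sub_mul, one_mul, (isRep_gen hq0).torus.J_K, sub_self]

theorem one_sub_J_mul_Kbar (hq0 : q ≠ 0) (i j : Fin (n - 1)) :
    ((1 - J i) * Kbar j : Alg k q n d) = 0 := by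
  rw [sub_mul, one_mul, (isRep_gen hq0).torus.J_Kb, sub_self]

/-- On the ideal generated by `J` the map `antipode` is a right convolution inverse of `id`. -/
theorem J_mul_convolution_id_antipode (hq0 : q ≠ 0) (i : Fin (n - 1)) (x : Alg k q n d) :
    J i * convolution (comul hq0) LinearMap.id (antipode hq0) x = counit hq0 x • J i := by
  have hT := antipode_mul (d := d) hq0
  induction x using Alg.induction with
  | algebraMap r =>
    simp [convolution, Algebra.algebraMap_eq_smul_one, Algebra.TensorProduct.one_def,
      antipode_one]
  | gen x =>
    have t := (isRep_gen (d := d) hq0).torus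
    cases x with
    | E j =>
      have : (J i * unitPart (d (.inl j)) (J j) : Alg k q n d) * (E j * Kbar j)
          = J i * (E j * Kbar j) := by rw [J_mul_unitPart hq0]
      have e : convolution (comul (d := d) hq0) LinearMap.id (antipode hq0) (E j) =
          (-1 : k) • (unitPart (d (.inl j)) (J j) * (E j * Kbar j)) + E j * Kbar j := by
        simp only [convolution, LinearMap.comp_apply, AlgHom.toLinearMap_apply, comul_E, map_add,
          TensorProduct.map_tmul, LinearMap.mul'_apply, LinearMap.id_apply, antipode_E_eq_smul,
          antipode_K, mul_smul_comm]
      rw [e, mul_add, mul_smul_comm, ← mul_assoc, this, counit_E, zero_smul]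
      module
    | F j =>
      have : (J i * (F j * unitPart (d (.inr j)) (J j)) : Alg k q n d)
          = J i * (Kbar j * (K j * F j)) := by
        rw [← (commute_unitPart (commute_J hq0 j _) _).eq, ← mul_assoc, J_mul_unitPart hq0,
          ← mul_assoc (Kbar j), ← (t.K_Kb_comm j j).eq, ← mul_assoc, J_mul_J hq0, J_eq hq0 i j]
      have e : convolution (comul (d := d) hq0) LinearMap.id (antipode hq0) (F j) =
          F j * unitPart (d (.inr j)) (J j) + (-1 : k) • (Kbar j * (K j * F j)) := by
        simp only [convolution, LinearMap.comp_apply, AlgHom.toLinearMap_apply, comul_F, map_add,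
          TensorProduct.map_tmul, LinearMap.mul'_apply, LinearMap.id_apply, antipode_F_eq_smul,
          antipode_unitPart, mul_smul_comm]
      rw [e, mul_add, mul_smul_comm, this, counit_F, zero_smul]
      module
    | K j => simpa [convolution, comul_K, counit_K, antipode_K] using
        (J_mul_J hq0 i j).trans (J_eq hq0 j i)
    | Kbar j => simpa [convolution, comul_Kbar, counit_Kbar, antipode_Kbar,
        ← (t.K_Kb_comm j j).eq] using (J_mul_J hq0 i j).trans (J_eq hq0 j i)
  | mul a b ha hb =>
    simp only [convolution, LinearMap.comp_apply, AlgHom.toLinearMap_apply, map_mul] at ha hb ⊢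
    rw [central_mul_mul'_map_id_anti_mul hT (commute_J hq0 i) hb, ha, smul_smul, mul_comm]
  | add a b ha hb => simp only [map_add, mul_add, ha, hb, add_smul]

/-- On the ideal generated by `J` the map `antipode` is a left convolution inverse of `id`. -/
theorem J_mul_convolution_antipode_id (hq0 : q ≠ 0) (i : Fin (n - 1)) (x : Alg k q n d) :
    J i * convolution (comul hq0) (antipode hq0) LinearMap.id x = counit hq0 x • J i := by
  have hT := antipode_mul (d := d) hq0
  induction x using Alg.induction with
  | algebraMap r =>
    simp [convolution, Algebra.algebraMap_eq_smul_one, Algebra.TensorProduct.one_def,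
      antipode_one]
  | gen x =>
    have t := (isRep_gen (d := d) hq0).torus
    cases x with
    | E j =>
      have : (J i * (unitPart (d (.inl j)) (J j) * E j) : Alg k q n d)
          = J i * (E j * (Kbar j * K j)) := by
        rw [← mul_assoc, J_mul_unitPart hq0, ← (t.K_Kb_comm j j).eq, ← (commute_J hq0 j _).eq,
          ← mul_assoc, J_mul_J hq0, J_eq hq0 i j]
      have e : convolution (comul (d := d) hq0) (antipode hq0) LinearMap.id (E j) =
          unitPart (d (.inl j)) (J j) * E j + (-1 : k) • (E j * (Kbar j * K j)) := by
        simp only [convolution, LinearMap.comp_apply, AlgHom.toLinearMap_apply, comul_E, map_add,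
          TensorProduct.map_tmul, LinearMap.mul'_apply, LinearMap.id_apply, antipode_E_eq_smul,
          antipode_unitPart, smul_mul_assoc, mul_assoc]
      rw [e, mul_add, mul_smul_comm, this, counit_E, zero_smul]
      module
    | F j =>
      have : (J i * (K j * F j * unitPart (d (.inr j)) (J j)) : Alg k q n d)
          = J i * (K j * F j) := by
        rw [← (commute_unitPart (commute_J hq0 j _) _).eq, ← mul_assoc, J_mul_unitPart hq0]
      have e : convolution (comul (d := d) hq0) (antipode hq0) LinearMap.id (F j) =
          (-1 : k) • (K j * F j * unitPart (d (.inr j)) (J j)) + K j * F j := by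
        simp only [convolution, LinearMap.comp_apply, AlgHom.toLinearMap_apply, comul_F, map_add,
          TensorProduct.map_tmul, LinearMap.mul'_apply, LinearMap.id_apply, antipode_F_eq_smul,
          antipode_Kbar, smul_mul_assoc]
      rw [e, mul_add, mul_smul_comm, this, counit_F, zero_smul]
      module
    | K j => simpa [convolution, comul_K, counit_K, antipode_K,
        ← (t.K_Kb_comm j j).eq] using (J_mul_J hq0 i j).trans (J_eq hq0 j i)
    | Kbar j => simpa [convolution, comul_Kbar, counit_Kbar, antipode_Kbar] using
        (J_mul_J hq0 i j).trans (J_eq hq0 j i)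
  | mul a b ha hb =>
    simp only [convolution, LinearMap.comp_apply, AlgHom.toLinearMap_apply, map_mul] at ha hb ⊢
    rw [central_mul_mul'_map_anti_id_mul hT (commute_J hq0 i) ha, hb, smul_smul]
  | add a b ha hb => simp only [map_add, mul_add, ha, hb, add_smul]

/-- Every value of `T` on a generator contains some `K` or `Kbar`, which `1 - J` kills. An
anti-homomorphism can agree with a character here because scalars commute. -/
theorem one_sub_J_mul_antipode (hq0 : q ≠ 0) (i : Fin (n - 1)) (x : Alg k q n d) :
    (1 - J i) * antipode hq0 x =
      (1 - J i) * (Algebra.linearMap k _ ∘ₗ (augmentation hq0).toLinearMap) x := by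
  induction x using Alg.induction with
  | algebraMap r => simp [Algebra.algebraMap_eq_smul_one, antipode_one]
  | gen x =>
    have hc := commute_one_sub_J (d := d) hq0 i
    simp only [LinearMap.comp_apply, AlgHom.toLinearMap_apply, augmentation_gen, map_zero,
      mul_zero]
    cases x with
    | E j =>
      rw [antipode_E_eq_smul, mul_smul_comm, ← mul_assoc, (hc _).eq, mul_assoc,
        one_sub_J_mul_Kbar hq0, mul_zero, smul_zero]
    | F j => rw [antipode_F_eq_smul, mul_smul_comm, ← mul_assoc, one_sub_J_mul_K hq0, zero_mul,
        smul_zero]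
    | K j => rw [antipode_K, one_sub_J_mul_Kbar hq0]
    | Kbar j => rw [antipode_Kbar, one_sub_J_mul_K hq0]
  | mul a b ha hb =>
    have hc := commute_one_sub_J (d := d) hq0 i
    rw [antipode_mul, ← mul_assoc, hb, (hc _).eq, mul_assoc, ha, ← mul_assoc, ← (hc _).eq]
    simp only [LinearMap.comp_apply, AlgHom.toLinearMap_apply, Algebra.linearMap_apply, map_mul,
      mul_assoc]
    rw [Algebra.commutes (augmentation hq0 b)]
  | add a b ha hb => simp only [map_add, mul_add, ha, hb]

/-- The endomorphism `(id ⊗ χ) ∘ Δ`, where `χ` is the augmentation. It fixes the `F i` of type 1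
and annihilates the other generators. -/
noncomputable def projF (hq0 : q ≠ 0) : Alg k q n d →ₐ[k] Alg k q n d :=
  (Algebra.TensorProduct.rid k k _).toAlgHom.comp
    ((Algebra.TensorProduct.map (.id k _) (augmentation hq0)).comp (comul hq0))

/-- The endomorphism `(χ ⊗ id) ∘ Δ`, where `χ` is the augmentation. It fixes the `E i` of type 1
and annihilates the other generators. -/
noncomputable def projE (hq0 : q ≠ 0) : Alg k q n d →ₐ[k] Alg k q n d :=
  (Algebra.TensorProduct.lid k _).toAlgHom.comp
    ((Algebra.TensorProduct.map (augmentation hq0) (.id k _)).comp (comul hq0))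

/-! ### The two projections on the `1 - J` part. -/

section Projections

variable (hq0 : q ≠ 0) (i : Fin (n - 1))

theorem augmentation_unitPart (b : Bool) :
    augmentation (d := d) hq0 (unitPart b (J i)) = bif b then 1 else 0 := by
  cases b
  · simp [unitPart, augmentation_gen]
  · exact map_one _

theorem projF_E : projF (d := d) hq0 (E i) = 0 := by
  simp [projF, comul_E, augmentation_gen]
theorem projF_F : projF (d := d) hq0 (F i) = bif d (.inr i) then F i else 0 := by
  cases h : d (.inr i) <;> simp [projF, comul_F, augmentation_gen, augmentation_unitPart, h]
theorem projF_K : projF (d := d) hq0 (K i) = 0 := by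
  simp [projF, comul_K, augmentation_gen]
theorem projF_Kbar : projF (d := d) hq0 (Kbar i) = 0 := by
  simp [projF, comul_Kbar, augmentation_gen]

theorem projE_E : projE (d := d) hq0 (E i) = bif d (.inl i) then E i else 0 := by
  cases h : d (.inl i) <;> simp [projE, comul_E, augmentation_gen, augmentation_unitPart, h]
theorem projE_F : projE (d := d) hq0 (F i) = 0 := by
  simp [projE, comul_F, augmentation_gen]
theorem projE_K : projE (d := d) hq0 (K i) = 0 := by
  simp [projE, comul_K, augmentation_gen]
theorem projE_Kbar : projE (d := d) hq0 (Kbar i) = 0 := by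
  simp [projE, comul_Kbar, augmentation_gen]

/-- The commutator is zero or a multiple of `K - Kbar`, which `1 - J` kills. -/
theorem one_sub_J_mul_F_mul_E (hq0 : q ≠ 0) (i j l : Fin (n - 1)) :
    ((1 - J i) * (F j * E l) : Alg k q n d) = (1 - J i) * (E l * F j) := by
  have h := isRep_gen (d := d) hq0
  rw [eq_comm, ← sub_eq_zero, ← mul_sub]
  rcases eq_or_ne l j with rfl | hne
  · rw [h.EF_same, mul_smul_comm, mul_sub, one_sub_J_mul_K hq0, one_sub_J_mul_Kbar hq0, sub_zero,
      smul_zero]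
  · rw [h.EF_diff l j hne, mul_zero]

theorem one_sub_J_mul_commute_mul (hq0 : q ≠ 0) (i : Fin (n - 1)) {a b c : Alg k q n d}
    (h : (1 - J i) * (a * b) = (1 - J i) * (b * a))
    (h' : (1 - J i) * (a * c) = (1 - J i) * (c * a)) :
    (1 - J i) * (a * (b * c)) = (1 - J i) * (b * c * a) := by
  have hc := commute_one_sub_J (d := d) hq0 i
  rw [← mul_assoc a, ← mul_assoc, h, mul_assoc, mul_assoc b, ← mul_assoc, (hc b).eq, mul_assoc b,
    h', ← mul_assoc b, ← (hc b).eq, mul_assoc (1 - J i), ← mul_assoc b]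

theorem one_sub_J_mul_projF_mul_projE (x y : Alg k q n d) :
    (1 - J i) * (projF hq0 x * projE hq0 y) = (1 - J i) * (projE hq0 y * projF hq0 x) := by
  induction x using Alg.induction with
  | algebraMap r => simp only [AlgHom.commutes, Algebra.commutes]
  | gen x =>
    induction y using Alg.induction with
    | algebraMap r => simp only [AlgHom.commutes, Algebra.commutes]
    | gen y =>
      cases x <;> cases y <;>
        simp only [projF_E, projF_F, projF_K, projF_Kbar, projE_E, projE_F, projE_K, projE_Kbar,
          zero_mul, mul_zero]
      -- Only an `F j` against an `E l` survives; in all other cases one projection is zero.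
      rename_i j l
      cases d (.inr j) <;> cases d (.inl l) <;>
        simp only [cond_true, cond_false, zero_mul, mul_zero, one_sub_J_mul_F_mul_E hq0]
    | mul a b ha hb =>
      rw [map_mul]
      exact one_sub_J_mul_commute_mul hq0 i ha hb
    | add a b ha hb => simp only [map_add, mul_add, add_mul, ha, hb]
  | mul a b ha hb =>
    rw [map_mul]
    exact (one_sub_J_mul_commute_mul hq0 i ha.symm hb.symm).symm
  | add a b ha hb => simp only [map_add, mul_add, add_mul, ha, hb]

/-- Both sides are homomorphisms, so generators suffice, although the convolution `id * T * id`
itself is not known to be one. A second leg altered by `projE` always sits next to a first leg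
killed by `projF`. -/
theorem map_projF_projE_comp_comul :
    (Algebra.TensorProduct.map (projF hq0) (.id k (Alg k q n d))).comp (comul hq0) =
      (Algebra.TensorProduct.map (projF hq0) (projE hq0)).comp (comul hq0) := by
  refine algHom_ext (B := Alg k q n d ⊗[k] Alg k q n d) (fun i => ?_) (fun i => ?_)
    (fun i => ?_) (fun i => ?_)
  · cases h : d (.inl i) <;>
      simp [comul_E, projF_E, projE_E, unitPart, projF_K, h]
  · cases h : d (.inr i) <;>
      simp [comul_F, projF_F, projE_F, projE_K, unitPart, projF_Kbar, h]
  · simp [comul_K, projF_K]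
  · simp [comul_Kbar, projF_Kbar]

/-- Multiplication `m` is not a homomorphism, but it is one on a pair of commuting images, and the
images of `projF` and `projE` commute after multiplication by `1 - J`. -/
theorem one_sub_J_mul_mul'_map_mul (s t : Alg k q n d ⊗[k] Alg k q n d) :
    (1 - J i) * LinearMap.mul' k _ (Algebra.TensorProduct.map (projF hq0) (projE hq0) (s * t)) =
      ((1 - J i) * LinearMap.mul' k _ (Algebra.TensorProduct.map (projF hq0) (projE hq0) s)) *
        LinearMap.mul' k _ (Algebra.TensorProduct.map (projF hq0) (projE hq0) t) := by
  induction s with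
  | zero => simp
  | add s s' h h' => simp only [map_add, mul_add, add_mul, h, h']
  | tmul a b =>
    induction t with
    | zero => simp
    | add s s' h h' => simp only [map_add, mul_add, h, h']
    | tmul c e =>
      have hc := commute_one_sub_J (d := d) hq0 i
      simp only [Algebra.TensorProduct.tmul_mul_tmul, Algebra.TensorProduct.map_tmul,
        LinearMap.mul'_apply, map_mul]
      have := one_sub_J_mul_projF_mul_projE hq0 i c b
      calc (1 - J i) * (projF hq0 a * projF hq0 c * (projE hq0 b * projE hq0 e))
          = projF hq0 a * ((1 - J i) * (projF hq0 c * projE hq0 b)) * projE hq0 e := by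
            rw [← mul_assoc (projF hq0 a), ← (hc _).eq]
            simp only [mul_assoc]
        _ = (1 - J i) * (projF hq0 a * projE hq0 b) * (projF hq0 c * projE hq0 e) := by
            rw [this, ← mul_assoc (projF hq0 a), ← (hc _).eq]
            simp only [mul_assoc]

/-- Off the ideal generated by `J`, every element is recovered from its `projF` and `projE`
parts. -/
theorem one_sub_J_mul_mul'_map_comul (x : Alg k q n d) :
    (1 - J i) * LinearMap.mul' k _
      (Algebra.TensorProduct.map (projF hq0) (projE hq0) (comul hq0 x)) = (1 - J i) * x := by
  have h := isRep_gen (d := d) hq0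
  have kill {z : Alg k q n d} (hz : J i * z = z) : (1 - J i) * z = 0 := by
    rw [sub_mul, one_mul, hz, sub_self]
  induction x using Alg.induction with
  | algebraMap r => simp [Algebra.algebraMap_eq_smul_one, Algebra.TensorProduct.one_def]
  | gen x =>
    cases x with
    | E j =>
      cases hj : d (.inl j)
      · rw [kill (h.J_E j hj i)]
        simp [comul_E, projE_E, projE_K, hj]
      · simp [comul_E, projE_E, projE_K, hj, unitPart]
    | F j =>
      cases hj : d (.inr j)
      · rw [kill (h.J_F j hj i)]
        simp [comul_F, projF_F, projF_Kbar, hj]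
      · simp [comul_F, projF_F, projF_Kbar, hj, unitPart]
    | K j => simp [comul_K, projF_K, one_sub_J_mul_K hq0]
    | Kbar j => simp [comul_Kbar, projF_Kbar, one_sub_J_mul_Kbar hq0]
  | mul a b ha hb =>
    have hc := commute_one_sub_J (d := d) hq0 i
    rw [map_mul, one_sub_J_mul_mul'_map_mul, ha, (hc a).eq, mul_assoc, hb, ← mul_assoc,
      ← (hc a).eq, mul_assoc]
  | add a b ha hb => simp only [map_add, mul_add, ha, hb]

theorem rid_map_projE_augmentation_comul (x : Alg k q n d) :
    Algebra.TensorProduct.rid k k _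
        (Algebra.TensorProduct.map (projE hq0) (augmentation hq0) (comul hq0 x)) =
      algebraMap k _ (augmentation hq0 x) := by
  have : (Algebra.TensorProduct.rid k k _).toAlgHom.comp
        ((Algebra.TensorProduct.map (projE (d := d) hq0) (augmentation hq0)).comp (comul hq0)) =
      (Algebra.ofId k _).comp (augmentation hq0) := by
    refine algHom_ext (fun i => ?_) (fun i => ?_) (fun i => ?_) (fun i => ?_) <;>
      simp [comul_E, comul_F, comul_K, comul_Kbar, augmentation_gen, projE_F, projE_Kbar]
  exact DFunLike.congr_fun this x

theorem one_sub_J_mul_convolution_id_antipode (x : Alg k q n d) :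
    (1 - J i) * convolution (comul hq0) LinearMap.id (antipode hq0) x =
      (1 - J i) * (projF hq0).toLinearMap x := by
  refine (central_mul_mul'_map (commute_one_sub_J hq0 i) (fun _ => rfl)
    (one_sub_J_mul_antipode hq0 i) _).trans ?_
  exact congrArg _ (mul'_map_scalar_right (.id k _) (augmentation hq0) (comul hq0 x))

theorem one_sub_J_mul_convolution_antipode_id (x : Alg k q n d) :
    (1 - J i) * convolution (comul hq0) (antipode hq0) LinearMap.id x =
      (1 - J i) * (projE hq0).toLinearMap x := by
  refine (central_mul_mul'_map (commute_one_sub_J hq0 i) (one_sub_J_mul_antipode hq0 i)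
    (fun _ => rfl) _).trans ?_
  exact congrArg _ (mul'_map_scalar_left LinearMap.id (augmentation hq0) (comul hq0 x))

end Projections

/-! ### The weak antipode identities. -/

theorem lid_map_counit_comul (hq0 : q ≠ 0) (x : Alg k q n d) :
    Algebra.TensorProduct.lid k _
      (Algebra.TensorProduct.map (counit hq0) (.id k (Alg k q n d)) (comul hq0 x)) = x :=
  (Algebra.TensorProduct.lid k _).toEquiv.eq_symm_apply.mp
    (DFunLike.congr_fun (isBialgebra_comul_counit (d := d) hq0).counit_left x)

theorem convolution_id_antipode_id (hq0 : q ≠ 0) (i : Fin (n - 1)) :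
    convolution (comul (d := d) hq0) (convolution (comul hq0) LinearMap.id (antipode hq0))
      LinearMap.id = LinearMap.id := by
  refine LinearMap.ext fun x => eq_of_mul_eq_of_one_sub_mul_eq (J := J i) ?_ ?_
  · have hε : ∀ y, J i * convolution (comul (d := d) hq0) LinearMap.id (antipode hq0) y =
        J i * (Algebra.linearMap k _ ∘ₗ (counit hq0).toLinearMap) y := fun y => by
      simp [J_mul_convolution_id_antipode hq0, ← Algebra.commutes, ← Algebra.smul_def]
    refine (central_mul_mul'_map (commute_J hq0 i) hε (fun _ => rfl) _).trans (congrArg _ ?_)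
    exact (mul'_map_scalar_left _ _ _).trans (congrArg _ (lid_map_counit_comul hq0 x))
  · refine (central_mul_mul'_map (commute_one_sub_J hq0 i)
      (one_sub_J_mul_convolution_id_antipode hq0 i) (fun _ => rfl) _).trans ?_
    refine Eq.trans ?_ (one_sub_J_mul_mul'_map_comul hq0 i x)
    exact congrArg (fun z => (1 - J i) * LinearMap.mul' k _ z)
      (DFunLike.congr_fun (map_projF_projE_comp_comul hq0) x)

theorem convolution_antipode_id_antipode (hq0 : q ≠ 0) (i : Fin (n - 1)) :
    convolution (comul (d := d) hq0) (convolution (comul hq0) (antipode hq0) LinearMap.id)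
      (antipode hq0) = antipode hq0 := by
  refine LinearMap.ext fun x => eq_of_mul_eq_of_one_sub_mul_eq (J := J i) ?_ ?_
  · have hε : ∀ y, J i * convolution (comul (d := d) hq0) (antipode hq0) LinearMap.id y =
        J i * (Algebra.linearMap k _ ∘ₗ (counit hq0).toLinearMap) y := fun y => by
      simp [J_mul_convolution_antipode_id hq0, ← Algebra.commutes, ← Algebra.smul_def]
    refine (central_mul_mul'_map (commute_J hq0 i) hε (fun _ => rfl) _).trans (congrArg _ ?_)
    exact (mul'_map_scalar_left _ _ _).trans (congrArg _ (lid_map_counit_comul hq0 x))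
  · refine (central_mul_mul'_map (commute_one_sub_J hq0 i)
      (one_sub_J_mul_convolution_antipode_id hq0 i) (one_sub_J_mul_antipode hq0 i) _).trans ?_
    rw [one_sub_J_mul_antipode hq0 i]
    refine congrArg _ ((mul'_map_scalar_right (projE hq0) (augmentation hq0) _).trans ?_)
    exact rid_map_projE_augmentation_comul hq0 x

theorem isCoproduct_comul (hq0 : q ≠ 0) : IsCoproduct (comul (d := d) hq0) where
  comul_K := comul_K hq0
  comul_Kbar := comul_Kbar hq0
  comul_E_type1 i hi := by rw [comul_E, hi]; rfl
  comul_E_type2 i hi := by rw [comul_E, hi]; rfl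
  comul_F_type1 i hi := by rw [comul_F, hi]; rfl
  comul_F_type2 i hi := by rw [comul_F, hi]; rfl

theorem isCounit_counit (hq0 : q ≠ 0) : IsCounit (counit (d := d) hq0) :=
  ⟨counit_K hq0, counit_Kbar hq0, counit_E hq0, counit_F hq0⟩

theorem isAntipodeOnGenerators_antipode (hq0 : q ≠ 0) :
    IsAntipodeOnGenerators (antipode (d := d) hq0) :=
  ⟨antipode_K hq0, antipode_Kbar hq0, antipode_E hq0, antipode_F hq0⟩

theorem isWeakAntipode_antipode (hq0 : q ≠ 0) (i : Fin (n - 1)) :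
    IsWeakAntipode (comul (d := d) hq0) (antipode hq0) :=
  ⟨antipode_one hq0, antipode_mul hq0, convolution_antipode_id_antipode hq0 i,
    convolution_id_antipode_id hq0 i⟩

end WSl

theorem mainTheorem1 {k : Type*} [Field k] (q : k) (hq0 : q ≠ 0) (hq : q ^ 2 ≠ 1)
    (n : ℕ) (hn : 2 ≤ n) :
    Function.Bijective (WSl.typesOf n) ∧
    ∀ d : Fin (2 ^ (2 * (n - 1))),
      ∃ (Δ : WSl.Alg k q n (WSl.typesOf n d) →ₐ[k]
            WSl.Alg k q n (WSl.typesOf n d) ⊗[k] WSl.Alg k q n (WSl.typesOf n d))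
        (ε : WSl.Alg k q n (WSl.typesOf n d) →ₐ[k] k)
        (T : WSl.Alg k q n (WSl.typesOf n d) →ₗ[k] WSl.Alg k q n (WSl.typesOf n d)),
        WSl.IsCoproduct Δ ∧ WSl.IsCounit ε ∧ IsBialgebra Δ ε ∧
        WSl.IsAntipodeOnGenerators T ∧ IsWeakAntipode Δ T := by
  exact ⟨WSl.typesOf_bijective n, fun _ =>
    ⟨WSl.comul hq0, WSl.counit hq0, WSl.antipode hq0, WSl.isCoproduct_comul hq0,
      WSl.isCounit_counit hq0, WSl.isBialgebra_comul_counit hq0,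
      WSl.isAntipodeOnGenerators_antipode hq0,
      -- Splitting by `J` needs an index to express `J`; `2 ≤ n` provides the first simple root.
      WSl.isWeakAntipode_antipode hq0 ⟨0, by omega⟩⟩⟩
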